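/- For an integer $n\ge 0$, regard tensors of order $n$ on the Euclidean space $\mathbb{R}^3$ as $n$-linear forms $T:\mathbb{R}^3\times\dots\times\mathbb{R}^3\to\mathbb{R}$, with the scalar product $S\cdot T=\sum_{i_1,\dots,i_n}S_{i_1\dots i_n}T_{i_1\dots i_n}$ of components in an orthonormal basis. Let $\mathbb{H}^n(\mathbb{R}^3)$ be the space of harmonic tensors of order $n$, that is, of totally symmetric tensors $T$ of order $n$ whose trace (the contraction of two indices) vanishes; for $n\le 1$ the trace condition is void. For $H_1\in\mathbb{H}^{m}(\mathbb{R}^3)$ and $H_2\in\mathbb{H}^{n}(\mathbb{R}^3)$ let $$H_1\odot H_2=\frac{1}{(m+n)!}\sum_{\sigma\in\mathfrak{S}_{m+n}}\sigma\star(H_1\otimes H_2),\qquad (\sigma\star T)(x_1,\dots,x_{m+n})=T(x_{\sigma^{-1}(1)},\dots,x_{\sigma^{-1}(m+n)}),$$ be the symmetric tensor product, and let the harmonic product $H_1\ast H_2=(H_1\odot H_2)_0\in\mathbb{H}^{m+n}(\mathbb{R}^3)$ be its orthogonal projection onto $\mathbb{H}^{m+n}(\mathbb{R}^3)$. Then,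 for every integer $n\ge 0$ and every $H\in\mathbb{H}^{2n}(\mathbb{R}^3)$, there exist $H_1,H_2\in\mathbb{H}^{n}(\mathbb{R}^3)$ such that $$H=H_1\ast H_1-H_2\ast H_2 .$$ -/

import Mathlib

/-- The Euclidean space `ℝ³`. -/
abbrev E3 : Type := EuclideanSpace ℝ (Fin 3)

/-- Tensors of order `n` on `ℝ³`: the `n`-linear forms on `ℝ³`. -/
abbrev Tensor (n : ℕ) : Type := MultilinearMap ℝ (fun _ : Fin n => E3) ℝ

namespace Tensor

/-- The vector `e_k` of the canonical orthonormal basis of `ℝ³`. -/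
noncomputable def e (k : Fin 3) : E3 := EuclideanSpace.single k 1

/-- The components `T_{i₁ … iₙ} = T (e_{i₁}, …, e_{iₙ})` of a tensor. -/
noncomputable def component {n : ℕ} (T : Tensor n) (i : Fin n → Fin 3) : ℝ :=
  T (fun a => e (i a))

theorem component_add {n : ℕ} (S T : Tensor n) (i : Fin n → Fin 3) :
    (S + T).component i = S.component i + T.component i := rfl

theorem component_smul {n : ℕ} (c : ℝ) (T : Tensor n) (i : Fin n → Fin 3) :
    (c • T).component i = c * T.component i := rfl

theorem eq_zero_of_component {n : ℕ} (T : Tensor n) (h : ∀ i, T.component i = 0) : T = 0 := by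
  refine Module.Basis.ext_multilinear (fun _ => (EuclideanSpace.basisFun (Fin 3) ℝ).toBasis) ?_
  intro i
  simpa [component, e] using h i

/-- The Euclidean scalar product of tensors,
`S · T = ∑ S_{i₁ … iₙ} T_{i₁ … iₙ}` (sum over all multi-indices). -/
@[reducible]
noncomputable def innerCore (n : ℕ) : InnerProductSpace.Core ℝ (Tensor n) where
  inner S T := ∑ i : Fin n → Fin 3, S.component i * T.component i
  conj_inner_symm S T := by
    simp only [conj_trivial]
    exact Finset.sum_congr rfl fun i _ => mul_comm _ _
  re_inner_nonneg T := by
    simpa using Finset.sum_nonneg fun i _ => mul_self_nonneg (T.component i)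
  add_left S T U := by
    simp only [component_add, add_mul, Finset.sum_add_distrib]
  smul_left S T c := by
    simp only [component_smul, conj_trivial, Finset.mul_sum, mul_assoc]
  definite T h := by
    refine eq_zero_of_component T fun i => ?_
    have h' := (Finset.sum_eq_zero_iff_of_nonneg
      (fun i _ => mul_self_nonneg (T.component i))).1 h i (Finset.mem_univ i)
    exact mul_self_eq_zero.1 h'

noncomputable instance instNormedAddCommGroup (n : ℕ) : NormedAddCommGroup (Tensor n) :=
  @InnerProductSpace.Core.toNormedAddCommGroup ℝ (Tensor n) _ _ _ (innerCore n)

noncomputable instance instInnerProductSpace (n : ℕ) : InnerProductSpace ℝ (Tensor n) :=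
  InnerProductSpace.ofCore (innerCore n).toCore

theorem inner_def {n : ℕ} (S T : Tensor n) :
    inner ℝ S T = ∑ i : Fin n → Fin 3, S.component i * T.component i := rfl

/-- The action of the symmetric group:
`(σ ⋆ T) (x₁, …, xₙ) = T (x_{σ⁻¹(1)}, …, x_{σ⁻¹(n)})`. -/
def perm {n : ℕ} (σ : Equiv.Perm (Fin n)) : Tensor n →ₗ[ℝ] Tensor n where
  toFun T := T.domDomCongr σ⁻¹
  map_add' _ _ := rfl
  map_smul' _ _ := rfl

theorem perm_apply {n : ℕ} (σ : Equiv.Perm (Fin n)) (T : Tensor n) (x : Fin n → E3) :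
    perm σ T x = T (fun a => x (σ⁻¹ a)) := rfl

/-- `Symⁿ(ℝ³)`: the space of totally symmetric tensors of order `n`. -/
def Sym (n : ℕ) : Submodule ℝ (Tensor n) where
  carrier := {T | ∀ σ : Equiv.Perm (Fin n), perm σ T = T}
  add_mem' hS hT σ := by rw [map_add, hS σ, hT σ]
  zero_mem' σ := map_zero _
  smul_mem' c T hT σ := by rw [map_smul, hT σ]

/-- The trace (contraction of the first two indices, which for a totally symmetric tensor is the
contraction of any two indices). Tensors of order `0` and `1` have trace zero. -/
noncomputable def trace : (n : ℕ) → Tensor n →ₗ[ℝ] Tensor (n - 2)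
  | 0 => 0
  | 1 => 0
  | n + 2 =>
    { toFun := fun T => ((∑ k : Fin 3, (T.curryLeft (e k)).curryLeft (e k) : Tensor n))
      map_add' := fun S T => by
        ext x
        simp [Finset.sum_add_distrib]
      map_smul' := fun c T => by
        ext x
        simp [Finset.mul_sum] }

theorem trace_apply {n : ℕ} (T : Tensor (n + 2)) (x : Fin n → E3) :
    (trace (n + 2) T : Tensor n) x = ∑ k : Fin 3, T (Fin.cons (e k) (Fin.cons (e k) x)) := by
  simp [trace]

/-- `ℍⁿ(ℝ³)`: the space of harmonic tensors of order `n`, that is, of totally symmetric tensors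
with vanishing trace. -/
noncomputable def Harmonic (n : ℕ) : Submodule ℝ (Tensor n) :=
  Sym n ⊓ LinearMap.ker (trace n)

/-- The tensor product
`(S ⊗ T) (x₁, …, x_{m+n}) = S (x₁, …, x_m) * T (x_{m+1}, …, x_{m+n})`. -/
noncomputable def outer {m n : ℕ} (S : Tensor m) (T : Tensor n) : Tensor (m + n) :=
  ((LinearMap.mul' ℝ ℝ).compMultilinearMap (S.domCoprod T)).domDomCongr finSumFinEquiv

theorem outer_apply {m n : ℕ} (S : Tensor m) (T : Tensor n) (x : Fin (m + n) → E3) :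
    outer S T x = S (fun a => x (Fin.castAdd n a)) * T (fun a => x (Fin.natAdd m a)) := by
  simp [outer]

/-- The symmetric tensor product `S ⊙ T = (1 / (m + n)!) ∑_σ σ ⋆ (S ⊗ T)`. -/
noncomputable def symProd {m n : ℕ} (S : Tensor m) (T : Tensor n) : Tensor (m + n) :=
  ((Nat.factorial (m + n) : ℝ)⁻¹) • ∑ σ : Equiv.Perm (Fin (m + n)), perm σ (outer S T)

/-- The harmonic part `(T)₀`: the orthogonal projection of `T` onto `ℍⁿ(ℝ³)`. -/
noncomputable def harmonicPart {n : ℕ} (T : Tensor n) : Harmonic n :=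
  (Harmonic n).orthogonalProjectionOnto T

/-- The harmonic product `H₁ ∗ H₂ = (H₁ ⊙ H₂)₀` of two harmonic tensors. -/
noncomputable def harmonicProd {m n : ℕ} (H₁ : Harmonic m) (H₂ : Harmonic n) :
    Harmonic (m + n) :=
  harmonicPart (symProd (H₁ : Tensor m) (H₂ : Tensor n))

end Tensor

namespace Tensor

section

open Polynomial ComplexConjugate

/-- The coordinates of the curve `t ↦ (1 - t², i (1 + t²), 2 t)` on the isotropic cone of `ℂ³`. -/
noncomputable def cone : Fin 3 → ℂ[X] :=
  ![1 - X ^ 2, C Complex.I * (1 + X ^ 2), 2 * X]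

theorem C_I_mul_C_I : (C Complex.I * C Complex.I : ℂ[X]) = -1 := by
  rw [← C_mul, Complex.I_mul_I]; simp

theorem sum_cone_sq : ∑ k, cone k * cone k = 0 := by
  simp only [cone, Fin.sum_univ_three, Matrix.cons_val]
  linear_combination (1 + X ^ 2) ^ 2 * C_I_mul_C_I

/-- The restriction of the form `x ↦ T (x, …, x)` to the isotropic cone of `ℂ³`, as a polynomial
in the parameter of the cone. -/
noncomputable def conePoly (n : ℕ) : Tensor n →ₗ[ℝ] ℂ[X] where
  toFun T := ∑ i : Fin n → Fin 3, T.component i • ∏ a, cone (i a)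
  map_add' S T := by simp only [component_add, add_smul, Finset.sum_add_distrib]
  map_smul' c T := by
    simp only [component_smul, mul_smul, Finset.smul_sum, RingHom.id_apply]

theorem conePoly_apply {n : ℕ} (T : Tensor n) :
    conePoly n T = ∑ i : Fin n → Fin 3, T.component i • ∏ a, cone (i a) := rfl

theorem conePoly_perm {n : ℕ} (σ : Equiv.Perm (Fin n)) (T : Tensor n) :
    conePoly n (perm σ T) = conePoly n T := by
  rw [conePoly_apply, conePoly_apply]
  refine Fintype.sum_equiv (Equiv.arrowCongr σ (Equiv.refl (Fin 3))) _ _ fun i => ?_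
  exact congrArg ((perm σ T).component i • ·) (Equiv.prod_comp σ.symm fun a => cone (i a)).symm

theorem conePoly_outer {m n : ℕ} (S : Tensor m) (T : Tensor n) :
    conePoly (m + n) (outer S T) = conePoly m S * conePoly n T := by
  simp only [conePoly_apply]
  rw [Finset.sum_mul_sum, ← Fintype.sum_prod_type']
  refine (Fintype.sum_equiv (Fin.appendEquiv m n) _ _ fun i => ?_).symm
  simp only [Fin.appendEquiv, Equiv.coe_fn_mk, component, outer_apply, Fin.append_left,
    Fin.append_right, Fin.prod_univ_add]
  rw [smul_mul_smul_comm]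

theorem conePoly_symProd {m n : ℕ} (S : Tensor m) (T : Tensor n) :
    conePoly (m + n) (symProd S T) = conePoly m S * conePoly n T := by
  have h : ((m + n).factorial : ℝ) ≠ 0 := by positivity
  simp only [symProd, map_smul, map_sum, conePoly_perm, conePoly_outer, Finset.sum_const,
    Finset.card_univ, Fintype.card_perm, Fintype.card_fin]
  rw [← Nat.cast_smul_eq_nsmul ℝ, smul_smul, inv_mul_cancel₀ h, one_smul]

/-- The real tensor `φ ∘ (z ⊗ ⋯ ⊗ z)` attached to a vector `z` of `ℂ³` and a real linear form `φ`
on `ℂ`. -/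
noncomputable def powTensor (n : ℕ) (z : Fin 3 → ℂ) (φ : ℂ →ₗ[ℝ] ℝ) : Tensor n :=
  φ.compMultilinearMap ((MultilinearMap.mkPiAlgebra ℝ (Fin n) ℂ).compLinearMap fun _ =>
    ∑ k, (EuclideanSpace.proj k : E3 →L[ℝ] ℝ).toLinearMap.smulRight (z k))

theorem powTensor_apply {n : ℕ} (z : Fin 3 → ℂ) (φ : ℂ →ₗ[ℝ] ℝ) (x : Fin n → E3) :
    powTensor n z φ x = φ (∏ a, ∑ k, x a k • z k) := by
  simp [powTensor]

theorem sum_e_smul (z : Fin 3 → ℂ) (j : Fin 3) : ∑ k, (e j) k • z k = z j := by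
  simp [e]

theorem component_powTensor {n : ℕ} (z : Fin 3 → ℂ) (φ : ℂ →ₗ[ℝ] ℝ) (i : Fin n → Fin 3) :
    (powTensor n z φ).component i = φ (∏ a, z (i a)) := by
  simp only [component, powTensor_apply, sum_e_smul]

theorem powTensor_mem_harmonic (n : ℕ) {z : Fin 3 → ℂ} (hz : ∑ k, z k * z k = 0)
    (φ : ℂ →ₗ[ℝ] ℝ) : powTensor n z φ ∈ Harmonic n := by
  refine ⟨fun σ => ?_, ?_⟩
  · ext x
    rw [perm_apply, powTensor_apply, powTensor_apply]
    exact congrArg φ (Equiv.prod_comp σ⁻¹ fun a => ∑ k, x a k • z k)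
  · change trace n _ = 0
    match n with
    | 0 => rfl
    | 1 => rfl
    | n + 2 =>
      ext x
      rw [trace_apply]
      simp only [powTensor_apply, Fin.prod_univ_succ, Fin.cons_zero, Fin.cons_succ, sum_e_smul,
        ← mul_assoc]
      rw [← map_sum, ← Finset.sum_mul, hz, zero_mul, map_zero]
      rfl

theorem apply_eval_conePoly {n : ℕ} (T : Tensor n) (t : ℂ) (φ : ℂ →ₗ[ℝ] ℝ) :
    φ ((conePoly n T).eval t) = inner ℝ T (powTensor n (fun k => (cone k).eval t) φ) := by
  simp only [conePoly_apply, inner_def, component_powTensor, eval_finsetSum, eval_smul, map_sum,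
    map_smul, eval_prod, smul_eq_mul]

theorem conePoly_eq_zero_of_mem_orthogonal {n : ℕ} {T : Tensor n} (hT : T ∈ (Harmonic n)ᗮ) :
    conePoly n T = 0 := by
  refine Polynomial.funext fun t => ?_
  have hz : ∑ k, (cone k).eval t * (cone k).eval t = 0 := by
    simpa [eval_finsetSum] using congrArg (Polynomial.eval t) sum_cone_sq
  have key (φ : ℂ →ₗ[ℝ] ℝ) : φ ((conePoly n T).eval t) = 0 := by
    rw [apply_eval_conePoly]
    exact (Submodule.mem_orthogonal' _ _).1 hT _ (powTensor_mem_harmonic n hz φ)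
  rw [eval_zero]
  exact Complex.ext (key Complex.reLm) (key Complex.imLm)

theorem conePoly_harmonicPart {n : ℕ} (T : Tensor n) :
    conePoly n (harmonicPart T : Tensor n) = conePoly n T := by
  have h := conePoly_eq_zero_of_mem_orthogonal
    ((Harmonic n).sub_starProjection_mem_orthogonal T)
  rw [map_sub, sub_eq_zero] at h
  exact h.symm

theorem conePoly_harmonicProd {m n : ℕ} (S : Harmonic m) (T : Harmonic n) :
    conePoly (m + n) (harmonicProd S T : Tensor (m + n)) =
      conePoly m (S : Tensor m) * conePoly n (T : Tensor n) := by
  rw [harmonicProd, conePoly_harmonicPart, conePoly_symProd]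

/-! ### A harmonic tensor is determined by its restriction to the isotropic cone -/

/-- The tensor obtained by fixing the first index. -/
noncomputable def slice {n : ℕ} (k : Fin 3) (T : Tensor (n + 1)) : Tensor n := T.curryLeft (e k)

theorem slice_apply {n : ℕ} (k : Fin 3) (T : Tensor (n + 1)) (x : Fin n → E3) :
    slice k T x = T (Fin.cons (e k) x) := rfl

theorem component_slice {n : ℕ} (k : Fin 3) (T : Tensor (n + 1)) (i : Fin n → Fin 3) :
    (slice k T).component i = T.component (Fin.cons k i) := by
  rw [component, component, slice_apply]
  congr 1
  funext a
  refine Fin.cases ?_ (fun a => ?_) a <;> simp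

theorem conePoly_succ {n : ℕ} (T : Tensor (n + 1)) :
    conePoly (n + 1) T = ∑ k, cone k * conePoly n (slice k T) := by
  simp only [conePoly_apply, Finset.mul_sum]
  rw [← Fintype.sum_prod_type']
  refine (Fintype.sum_equiv (Fin.consEquiv fun _ => Fin 3) _ _ fun i => ?_).symm
  simp only [Fin.consEquiv_apply, Fin.prod_univ_succ, Fin.cons_zero, Fin.cons_succ,
    component_slice, mul_smul_comm]
  rfl

theorem slice_mem_Sym {n : ℕ} {T : Tensor (n + 1)} (hT : T ∈ Sym (n + 1)) (k : Fin 3) :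
    slice k T ∈ Sym n := by
  intro σ
  ext x
  have h := congrArg (fun S : Tensor (n + 1) => S (Fin.cons (e k) x))
    (hT (Equiv.Perm.decomposeFin.symm (0, σ)))
  simp only [perm_apply] at h
  rw [perm_apply, slice_apply, slice_apply, ← h]
  congr 1
  funext a
  have hinv : ((Equiv.Perm.decomposeFin.symm (0, σ))⁻¹ : Equiv.Perm (Fin (n + 1))) =
      Equiv.Perm.decomposeFin.symm (0, σ⁻¹) := by
    rw [inv_eq_iff_mul_eq_one]
    ext b
    refine Fin.cases ?_ (fun b => ?_) b <;> simp
  rw [hinv]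
  refine Fin.cases ?_ (fun a => ?_) a <;> simp

theorem slice_slice_comm {n : ℕ} {T : Tensor (n + 2)} (hT : T ∈ Sym (n + 2)) (k l : Fin 3) :
    slice k (slice l T) = slice l (slice k T) := by
  ext x
  have h := congrArg (fun S : Tensor (n + 2) => S (Fin.cons (e k) (Fin.cons (e l) x)))
    (hT (Equiv.swap 0 1))
  simp only [perm_apply] at h
  simp only [slice_apply]
  rw [← h]
  congr 1
  funext a
  refine Fin.cases ?_ (fun a => Fin.cases ?_ (fun a => ?_) a) a
  · simp
  · simp
  · rw [Equiv.swap_inv, Equiv.swap_apply_of_ne_of_ne (by simp [Fin.ext_iff])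
      (by simp [Fin.ext_iff])]
    simp

theorem trace_eq_sum_slice {n : ℕ} (T : Tensor (n + 2)) :
    trace (n + 2) T = ∑ k, slice k (slice k T) := rfl

theorem slice_sum {n : ℕ} {ι : Type*} (s : Finset ι) (k : Fin 3) (T : ι → Tensor (n + 1)) :
    slice k (∑ j ∈ s, T j) = ∑ j ∈ s, slice k (T j) := by
  ext x
  simp [slice_apply]

theorem slice_mem_harmonic {n : ℕ} {T : Tensor (n + 1)} (hT : T ∈ Harmonic (n + 1)) (k : Fin 3) :
    slice k T ∈ Harmonic n := by
  refine ⟨slice_mem_Sym hT.1 k, ?_⟩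
  change trace n _ = 0
  match n with
  | 0 => rfl
  | 1 => rfl
  | n + 2 =>
    have h : trace (n + 3) T = 0 := hT.2
    rw [trace_eq_sum_slice] at h
    rw [trace_eq_sum_slice]
    have h' := congrArg (slice k) h
    rw [slice_sum] at h'
    refine Eq.trans (Finset.sum_congr rfl fun j _ => ?_) h'
    rw [slice_slice_comm hT.1 j k, slice_slice_comm (slice_mem_Sym hT.1 j) j k]

theorem derivative_conePoly_zero (T : Tensor 0) : derivative (conePoly 0 T) = 0 := by
  simp [conePoly_apply]

theorem derivative_conePoly {n : ℕ} {T : Tensor (n + 1)} (hT : T ∈ Sym (n + 1)) :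
    derivative (conePoly (n + 1) T) =
      (n + 1 : ℂ[X]) * ∑ k, derivative (cone k) * conePoly n (slice k T) := by
  induction n with
  | zero =>
    simp [conePoly_succ T, derivative_mul, derivative_conePoly_zero]
  | succ n ih =>
    have h1 : ∑ k, cone k * derivative (conePoly (n + 1) (slice k T)) =
        (n + 1 : ℂ[X]) * ∑ k, derivative (cone k) * conePoly (n + 1) (slice k T) := by
      have hk (k : Fin 3) := ih (slice_mem_Sym hT k)
      simp only [hk]
      simp only [conePoly_succ (slice _ T), Finset.mul_sum]
      rw [Finset.sum_comm]
      refine Finset.sum_congr rfl fun k _ => Finset.sum_congr rfl fun l _ => ?_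
      rw [slice_slice_comm hT]
      ring
    rw [conePoly_succ T, derivative_sum]
    simp only [derivative_mul, Finset.sum_add_distrib]
    rw [h1]
    push_cast
    ring

theorem derivative_cone_mul (k l : Fin 3) :
    derivative (cone k) * derivative (cone l) = (if k = l then 4 else 0) +
      cone k * derivative (derivative (cone l)) + derivative (derivative (cone k)) * cone l := by
  have hI := C_I_mul_C_I
  fin_cases k <;> fin_cases l <;>
    simp [cone, derivative_pow, show (C 2 : ℂ[X]) = 2 from rfl] <;> grind

theorem derivative_cone_mul_derivative_conePoly {n : ℕ} {T : Tensor (n + 1)}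
    (hT : T ∈ Sym (n + 1)) (k : Fin 3) :
    derivative (cone k) * derivative (conePoly (n + 1) T) = (n + 1 : ℂ[X]) *
      (4 * conePoly n (slice k T) +
        ∑ l, cone k * derivative (derivative (cone l)) * conePoly n (slice l T) +
        ∑ l, derivative (derivative (cone k)) * cone l * conePoly n (slice l T)) := by
  have h (l : Fin 3) : derivative (cone k) * (derivative (cone l) * conePoly n (slice l T)) =
      (if k = l then 4 * conePoly n (slice l T) else 0) +
        cone k * derivative (derivative (cone l)) * conePoly n (slice l T) +
        derivative (derivative (cone k)) * cone l * conePoly n (slice l T) := by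
    rw [← mul_assoc, derivative_cone_mul]
    split_ifs <;> ring
  have h' := derivative_conePoly hT
  rw [h', mul_left_comm, Finset.mul_sum]
  simp only [h, Finset.sum_add_distrib, Finset.sum_ite_eq, Finset.mem_univ, if_true]

theorem sum_derivative_derivative_cone {n : ℕ} {T : Tensor (n + 1)} (hT : T ∈ Harmonic (n + 1))
    (h : ∑ k, derivative (cone k) * conePoly n (slice k T) = 0) :
    ∑ k, derivative (derivative (cone k)) * conePoly n (slice k T) = 0 := by
  have h' := congrArg derivative h
  simp only [derivative_sum, derivative_mul, Finset.sum_add_distrib, derivative_zero] at h'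
  cases n with
  | zero => simpa [derivative_conePoly_zero] using h'
  | succ n =>
    set D := ∑ k, derivative (derivative (cone k)) * conePoly (n + 1) (slice k T) with hD
    have htr : ∑ k, conePoly n (slice k (slice k T)) = 0 := by
      rw [← map_sum, ← trace_eq_sum_slice, show trace (n + 2) T = 0 from hT.2]
      exact map_zero _
    have hD1 : ∑ k, ∑ l, derivative (derivative (cone k)) * cone l *
        conePoly n (slice l (slice k T)) = D := by
      simp only [hD, conePoly_succ (slice _ T), Finset.mul_sum, mul_assoc]
    have hD2 : ∑ k, ∑ l, cone k * derivative (derivative (cone l)) *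
        conePoly n (slice l (slice k T)) = D := by
      rw [← hD1, Finset.sum_comm]
      refine Finset.sum_congr rfl fun k _ => Finset.sum_congr rfl fun l _ => ?_
      rw [slice_slice_comm hT.1]
      ring
    have hsum : ∑ k, derivative (cone k) * derivative (conePoly (n + 1) (slice k T)) =
        (n + 1 : ℂ[X]) * (D + D) := by
      have hk (k : Fin 3) :=
        derivative_cone_mul_derivative_conePoly (slice_mem_Sym hT.1 k) k
      simp only [hk]
      rw [← Finset.mul_sum, Finset.sum_add_distrib, Finset.sum_add_distrib, ← Finset.mul_sum,
        htr, hD1, hD2]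
      ring
    rw [hsum] at h'
    have h3 : ((2 * n + 3 : ℕ) : ℂ[X]) * D = 0 := by
      push_cast
      linear_combination h'
    exact (mul_eq_zero.1 h3).resolve_left (Nat.cast_ne_zero.2 (by omega))

theorem eq_zero_of_conePoly_eq_zero {n : ℕ} {T : Tensor n} (hT : T ∈ Harmonic n)
    (h : conePoly n T = 0) : T = 0 := by
  induction n with
  | zero =>
    refine eq_zero_of_component T fun i => ?_
    have h' : T.component i • (1 : ℂ[X]) = 0 := by
      rw [← h, conePoly_apply, Fintype.sum_unique, Fin.prod_univ_zero, Subsingleton.elim i]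
    exact (smul_eq_zero.1 h').resolve_right one_ne_zero
  | succ n ih =>
    have hB : ∑ k, derivative (cone k) * conePoly n (slice k T) = 0 := by
      have h' := derivative_conePoly hT.1
      rw [h, derivative_zero] at h'
      exact (mul_eq_zero.1 h'.symm).resolve_left (by exact_mod_cast n.succ_ne_zero)
    have hD := sum_derivative_derivative_cone hT hB
    have hA := h
    rw [conePoly_succ] at hA
    have hI := C_I_mul_C_I
    simp [cone, Fin.sum_univ_three, derivative_pow, show (C 2 : ℂ[X]) = 2 from rfl] at hA hB hD
    have h4 : (4 : ℂ[X]) ≠ 0 := by exact_mod_cast (Nat.cast_ne_zero (R := ℂ[X])).2 four_ne_zero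
    have aux (a b c i x : ℂ[X]) (hi : i * i = -1)
        (hA : (1 - x ^ 2) * a + i * (1 + x ^ 2) * b + 2 * x * c = 0)
        (hB : -(2 * x * a) + i * (2 * x) * b + 2 * c = 0) (hD : -(2 * a) + i * 2 * b = 0) :
        a = 0 ∧ b = 0 ∧ c = 0 :=
      ⟨mul_left_cancel₀ h4 (by grind), mul_left_cancel₀ h4 (by grind),
        mul_left_cancel₀ h4 (by grind)⟩
    obtain ⟨k0, k1, k2⟩ := aux _ _ _ _ _ hI hA hB hD
    have key (k : Fin 3) : conePoly n (slice k T) = 0 := by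
      fin_cases k
      exacts [k0, k1, k2]
    refine eq_zero_of_component T fun i => ?_
    have hs := ih (slice_mem_harmonic hT (i 0)) (key (i 0))
    have := component_slice (i 0) T (Fin.tail i)
    rw [hs, Fin.cons_self_tail] at this
    exact this.symm

theorem conePoly_injective {n : ℕ} {S T : Harmonic n}
    (h : conePoly n (S : Tensor n) = conePoly n (T : Tensor n)) : S = T := by
  rw [← sub_eq_zero, ← map_sub] at h
  exact Subtype.ext (sub_eq_zero.1 (eq_zero_of_conePoly_eq_zero (sub_mem S.2 T.2) h))

/-! ### Polynomials that are real for the antipodal real structure -/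

/-- The real structure on binary forms of degree `2 N` induced by the antipodal map
`t ↦ -1 / conj t`. -/
noncomputable def antipode (N : ℕ) (f : ℂ[X]) : ℂ[X] :=
  (-1) ^ N * (reflect (2 * N) (f.map (starRingEnd ℂ))).comp (-X)

/-- Polynomials of degree at most `2 N` invariant under the antipodal real structure. -/
structure IsReal (N : ℕ) (f : ℂ[X]) : Prop where
  natDegree_le : f.natDegree ≤ 2 * N
  antipode_eq : antipode N f = f

theorem antipode_mul {M N : ℕ} {f g : ℂ[X]} (hf : f.natDegree ≤ 2 * M)
    (hg : g.natDegree ≤ 2 * N) : antipode (M + N) (f * g) = antipode M f * antipode N g := by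
  rw [antipode, mul_add, Polynomial.map_mul, reflect_mul _ _ (natDegree_map_le.trans hf)
    (natDegree_map_le.trans hg), mul_comp, antipode, antipode]
  ring

theorem antipode_add (N : ℕ) (f g : ℂ[X]) :
    antipode N (f + g) = antipode N f + antipode N g := by
  simp [antipode, reflect_add, mul_add]

theorem antipode_smul (N : ℕ) (c : ℝ) (f : ℂ[X]) : antipode N (c • f) = c • antipode N f := by
  have h (g : ℂ[X]) : c • g = C (c : ℂ) * g := by
    ext; simp
  rw [h, h, antipode, antipode, Polynomial.map_mul, map_C, Complex.conj_ofReal, reflect_C_mul,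
    mul_comp, C_comp]
  ring

theorem IsReal.add {N : ℕ} {f g : ℂ[X]} (hf : IsReal N f) (hg : IsReal N g) :
    IsReal N (f + g) :=
  ⟨natDegree_add_le_of_degree_le hf.1 hg.1, by rw [antipode_add, hf.2, hg.2]⟩

theorem IsReal.smul {N : ℕ} {f : ℂ[X]} (hf : IsReal N f) (c : ℝ) : IsReal N (c • f) :=
  ⟨(natDegree_smul_le c f).trans hf.1, by rw [antipode_smul, hf.2]⟩

theorem isReal_zero (N : ℕ) : IsReal N 0 := ⟨by simp, by simp [antipode]⟩

theorem isReal_one : IsReal 0 1 := ⟨by simp, by simp [antipode]⟩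

theorem IsReal.mul {M N : ℕ} {f g : ℂ[X]} (hf : IsReal M f) (hg : IsReal N g) :
    IsReal (M + N) (f * g) :=
  ⟨natDegree_mul_le.trans (by have := hf.1; have := hg.1; omega),
    by rw [antipode_mul hf.1 hg.1, hf.2, hg.2]⟩

theorem isReal_cone (k : Fin 3) : IsReal 1 (cone k) := by
  constructor
  · fin_cases k <;> simp only [cone, Fin.mk_one, Fin.zero_eta, Fin.reduceFinMk, Matrix.cons_val] <;>
      compute_degree!
  · have hX : reflect 2 (X : ℂ[X]) = X := by simpa using reflect_monomial (R := ℂ) 2 1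
    have hX2 : reflect 2 (X ^ 2 : ℂ[X]) = 1 := by
      simpa [-reflect_monomial] using reflect_monomial (R := ℂ) 2 2
    have h1 : reflect 2 (1 : ℂ[X]) = X ^ 2 := by
      simp
    have h2 : reflect 2 (2 * X : ℂ[X]) = 2 * X := by
      rw [show (2 : ℂ[X]) = C 2 from rfl, reflect_C_mul, hX]
    fin_cases k
    · simp [cone, antipode, reflect_sub, hX2, h1]
    · simp [cone, antipode, reflect_add, reflect_neg, hX2, h1]
      ring
    · simp [cone, antipode, h2]

theorem isReal_prod_cone {n : ℕ} (i : Fin n → Fin 3) : IsReal n (∏ a, cone (i a)) := by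
  induction n with
  | zero => simpa using isReal_one
  | succ n ih =>
    rw [Fin.prod_univ_castSucc]
    exact (ih _).mul (isReal_cone _)

theorem isReal_conePoly {n : ℕ} (T : Tensor n) : IsReal n (conePoly n T) := by
  rw [conePoly_apply]
  exact Finset.sum_induction _ (IsReal n) (fun _ _ => IsReal.add) (isReal_zero n)
    fun i _ => (isReal_prod_cone i).smul _

theorem IsReal.coeff_eq {N : ℕ} {f : ℂ[X]} (hf : IsReal N f) :
    f.coeff (2 * N) = (-1) ^ N * conj (f.coeff 0) := by
  conv_lhs => rw [← hf.2]
  have h1 : ((-1) ^ N : ℂ[X]) = C ((-1) ^ N) := by simp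
  have h2 : (-X : ℂ[X]) = C (-1) * X := by simp
  rw [antipode, h1, coeff_C_mul, h2, comp_C_mul_X_coeff]
  simp [coeff_reflect, pow_mul]

theorem IsReal.isRoot_antipode {N : ℕ} {f : ℂ[X]} (hf : IsReal N f) {r : ℂ} (hr : r ≠ 0)
    (h : f.IsRoot r) : f.IsRoot (-(conj r)⁻¹) := by
  have h1 : (f.map (starRingEnd ℂ)).eval (conj r) = 0 := by
    rw [eval_map, eval₂_at_apply, h.eq_zero, map_zero]
  have hr' : conj r ≠ 0 := by simpa using hr
  let _ : Invertible (conj r) := invertibleOfNonzero hr'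
  have h2 := eval₂_reflect_mul_pow (RingHom.id ℂ) (conj r) (2 * N) (f.map (starRingEnd ℂ))
    (natDegree_map_le.trans hf.1)
  rw [eval₂_id, eval₂_id, h1, invOf_eq_inv] at h2
  have h3 := (mul_eq_zero.1 h2).resolve_right (pow_ne_zero _ hr')
  rw [IsRoot, ← hf.2, antipode]
  simp [eval_comp, h3]

/-- The linear form with prescribed coefficients. -/
noncomputable def linForm (v : Fin 3 → ℝ) : Tensor 1 :=
  MultilinearMap.ofSubsingleton ℝ E3 ℝ (0 : Fin 1)
    (∑ k, v k • (EuclideanSpace.proj k : E3 →L[ℝ] ℝ).toLinearMap)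

theorem conePoly_linForm (v : Fin 3 → ℝ) : conePoly 1 (linForm v) = ∑ k, v k • cone k := by
  rw [conePoly_apply]
  refine Fintype.sum_equiv (Equiv.funUnique (Fin 1) (Fin 3)) _ _ fun i => ?_
  simp [component, linForm, e]

theorem IsReal.of_mul_left {M N : ℕ} {f g : ℂ[X]} (hf : IsReal M f) (h0 : f ≠ 0)
    (hg : g.natDegree ≤ 2 * N) (h : IsReal (M + N) (f * g)) : IsReal N g := by
  refine ⟨hg, mul_left_cancel₀ h0 ?_⟩
  have := h.2
  rwa [antipode_mul hf.1 hg, hf.2] at this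

theorem IsReal.exists_eq_mul {N : ℕ} {f : ℂ[X]} (hf : IsReal (N + 1) f) :
    ∃ (T : Tensor 1) (g : ℂ[X]), IsReal N g ∧ f = conePoly 1 T * g := by
  rcases eq_or_ne f 0 with rfl | hf0
  · exact ⟨0, 0, isReal_zero N, by simp⟩
  obtain ⟨r, hr⟩ : ∃ r, f.IsRoot r := by
    refine Complex.exists_root ?_
    by_contra hd
    have hd' := natDegree_eq_zero_iff_degree_le_zero.2 (not_lt.1 hd)
    have h1 : f.coeff (2 * (N + 1)) = 0 := coeff_eq_zero_of_natDegree_lt (by omega)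
    rw [hf.coeff_eq] at h1
    rw [eq_C_of_natDegree_eq_zero hd'] at hf0
    simp at h1
    simp [h1] at hf0
  suffices h : ∃ (v : Fin 3 → ℝ) (g : ℂ[X]), f = (∑ k, v k • cone k) * g ∧
      g.natDegree ≤ 2 * N by
    obtain ⟨v, g, hfg, hg⟩ := h
    rw [← conePoly_linForm] at hfg
    refine ⟨linForm v, g, IsReal.of_mul_left (isReal_conePoly (linForm v)) ?_ hg ?_, hfg⟩
    · rintro h
      exact hf0 (by rw [hfg, h, zero_mul])
    · rwa [← hfg, add_comm]
  have hsm (c : ℝ) (p : ℂ[X]) : c • p = C (c : ℂ) * p := by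
    ext; simp
  rcases eq_or_ne r 0 with rfl | hr0
  · obtain ⟨g, rfl⟩ := X_dvd_iff.2 (coeff_zero_eq_eval_zero f ▸ hr.eq_zero)
    have hg0 : g ≠ 0 := right_ne_zero_of_mul hf0
    refine ⟨![0, 0, 1 / 2], g, ?_, ?_⟩
    · have : (C (1 / 2) * 2 : ℂ[X]) = 1 := by
        rw [show (2 : ℂ[X]) = C 2 from rfl, ← C_mul]
        norm_num
      simp only [hsm, cone, Fin.sum_univ_three, Matrix.cons_val]
      push_cast
      rw [← mul_assoc (C (1 / 2)), this]
      simp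
    · have h1 := hf.coeff_eq
      have h2 := hf.1
      rw [natDegree_X_mul hg0] at h2
      simp only [coeff_X_mul_zero, map_zero, mul_zero] at h1
      by_contra hlt
      have h3 : g.natDegree = 2 * N + 1 := by omega
      rw [show 2 * (N + 1) = (2 * N + 1) + 1 by ring, coeff_X_mul, ← h3] at h1
      exact hg0 (leadingCoeff_eq_zero.1 h1)
  · have hr' : conj r ≠ 0 := by simpa using hr0
    have hne : -(conj r)⁻¹ ≠ r := by
      intro h
      have h1 : r * conj r = -1 := by
        nth_rw 1 [← h]
        rw [neg_mul, inv_mul_cancel₀ hr']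
      rw [Complex.mul_conj] at h1
      have h2 : Complex.normSq r = -1 := by exact_mod_cast h1
      linarith [Complex.normSq_nonneg r]
    obtain ⟨g, rfl⟩ := dvd_iff_isRoot.2 hr
    have hs := hf.isRoot_antipode hr0 hr
    rw [IsRoot, eval_mul, eval_sub, eval_X, eval_C] at hs
    obtain ⟨g, rfl⟩ := dvd_iff_isRoot.2 ((mul_eq_zero.1 hs).resolve_left (sub_ne_zero.2 hne))
    have hg0 : g ≠ 0 := right_ne_zero_of_mul (right_ne_zero_of_mul hf0)
    refine ⟨![-r.re, -r.im, (1 - Complex.normSq r) / 2], C (conj r)⁻¹ * g, ?_, ?_⟩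
    · rw [← mul_assoc, ← mul_assoc]
      congr 1
      have hre : (C (r.re : ℂ) : ℂ[X]) + C (r.im : ℂ) * C Complex.I = C r := by
        rw [← C_mul, ← C_add, Complex.re_add_im]
      have him : (C (r.re : ℂ) : ℂ[X]) - C (r.im : ℂ) * C Complex.I = C (conj r) := by
        rw [← C_mul, ← C_sub]
        congr 1
        apply Complex.ext <;> simp
      have hns : (2 * C (((1 - Complex.normSq r) / 2 : ℝ) : ℂ) : ℂ[X]) =
          1 - C r * C (conj r) := by
        rw [← C_mul, Complex.mul_conj, show (2 : ℂ[X]) = C 2 from rfl, ← C_mul, ← C_1, ← C_sub]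
        congr 1
        push_cast
        ring
      have hinv : (C (conj r) * C (conj r)⁻¹ : ℂ[X]) = 1 := by
        rw [← C_mul, mul_inv_cancel₀ hr', C_1]
      simp only [hsm, cone, Fin.sum_univ_three, Matrix.cons_val, C_neg, Complex.ofReal_neg]
      grind
    · refine (natDegree_C_mul_le _ _).trans ?_
      have h1 := hf.1
      rw [natDegree_mul (X_sub_C_ne_zero _) (mul_ne_zero (X_sub_C_ne_zero _) hg0),
        natDegree_mul (X_sub_C_ne_zero _) hg0, natDegree_X_sub_C, natDegree_X_sub_C] at h1
      omega

theorem IsReal.exists_conePoly_eq {n : ℕ} {f : ℂ[X]} (hf : IsReal n f) :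
    ∃ T : Tensor n, conePoly n T = f := by
  induction n generalizing f with
  | zero =>
    have hc := hf.coeff_eq
    have hd := eq_C_of_natDegree_eq_zero (Nat.le_zero.1 hf.1)
    simp only [mul_zero, pow_zero, one_mul] at hc
    obtain ⟨c, hc⟩ := Complex.conj_eq_iff_real.1 hc.symm
    refine ⟨MultilinearMap.constOfIsEmpty ℝ _ c, ?_⟩
    rw [conePoly_apply, hd, hc, Fintype.sum_unique]
    ext
    simp [component, coeff_C, coeff_one]
  | succ n ih =>
    obtain ⟨T, g, hg, rfl⟩ := hf.exists_eq_mul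
    obtain ⟨S, rfl⟩ := ih hg
    exact ⟨outer S T, by rw [conePoly_outer, mul_comm]⟩

theorem IsReal.exists_mul {m n : ℕ} {f : ℂ[X]} (hf : IsReal (m + n) f) :
    ∃ p q, IsReal m p ∧ IsReal n q ∧ f = p * q := by
  induction n generalizing f with
  | zero => exact ⟨f, 1, hf, isReal_one, (mul_one f).symm⟩
  | succ n ih =>
    obtain ⟨T, g, hg, rfl⟩ := hf.exists_eq_mul
    obtain ⟨p, q, hp, hq, rfl⟩ := ih hg
    exact ⟨p, q * conePoly 1 T, hp, hq.mul (isReal_conePoly T), by ring⟩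

/-- Every harmonic tensor of order `m + n` is a harmonic product of harmonic tensors of orders
`m` and `n`. -/
theorem exists_harmonicProd_eq {m n : ℕ} (H : Harmonic (m + n)) :
    ∃ (P : Harmonic m) (Q : Harmonic n), H = harmonicProd P Q := by
  obtain ⟨p, q, hp, hq, h⟩ := (isReal_conePoly (H : Tensor (m + n))).exists_mul
  obtain ⟨P, rfl⟩ := hp.exists_conePoly_eq
  obtain ⟨Q, rfl⟩ := hq.exists_conePoly_eq
  refine ⟨harmonicPart P, harmonicPart Q, conePoly_injective ?_⟩
  rw [conePoly_harmonicProd, conePoly_harmonicPart, conePoly_harmonicPart, h]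

end

end Tensor

theorem mainTheorem3 (n : ℕ) (H : Tensor.Harmonic (n + n)) :
    ∃ H₁ H₂ : Tensor.Harmonic n,
      H = Tensor.harmonicProd H₁ H₁ - Tensor.harmonicProd H₂ H₂ := by
  obtain ⟨P, Q, rfl⟩ := Tensor.exists_harmonicProd_eq H
  refine ⟨(2⁻¹ : ℝ) • (P + Q), (2⁻¹ : ℝ) • (P - Q), Tensor.conePoly_injective ?_⟩
  simp only [Submodule.coe_sub, map_sub, Tensor.conePoly_harmonicProd, Submodule.coe_smul,
    Submodule.coe_add, map_smul, map_add, smul_mul_smul_comm]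
  rw [← smul_sub, show ∀ p q : Polynomial ℂ, (p + q) * (p + q) - (p - q) * (p - q) =
    (4 : ℝ) • (p * q) from fun p q => by
      rw [← Nat.cast_ofNat, Nat.cast_smul_eq_nsmul ℝ, nsmul_eq_mul]; push_cast; ring, smul_smul]
  norm_num
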